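/- **Actions.** An action $(X,S)$ is a group $S$ (written additively, not assumed commutative) with a right action $x+s$ on a set $X$ with base point $0_X$ (which need not be fixed by $S$). A morphism $f=(f',f''):(X,S)\to(Y,T)$ is a map $f':X\to Y$ with $f'(0_X)=0_Y$ and a group homomorphism $f'':S\to T$ with $f'(x+s)=f'(x)+f''(s)$; it is null if $f'(X)=\{0_Y\}$. This gives the category $\mathbf{Act}$ (of small actions). Let $\Sigma$ be the class of morphisms of $\mathbf{Act}$ which are isomorphic, as arrows, to a natural projection $(X,S)\to(X,S/N)$, with $N$ an invariant (normal) subgroup of $S$ acting trivially on $X$. **Normalised actions.** Let $\mathbf{Act}'$ be the category whose objects are the triples $(X,S,S_0)$ with $(X,S)$ an action and $S_0=\mathrm{Fix}_S(0_X)=\{s\in S\mid 0_X+s=0_X\}$; a morphism $f=(f',f''):(X,S,S_0)\to(Y,T,T_0)$ consists of a map $f':X\to Y$ with $f'(0_X)=0_Y$ and a quasi-homomorphism $f'':(S,S_0)\to(T,T_0)$, i.e. a mapping $f'':S\to T$ such that $\sum_i\varepsilon_i s_i\in S_0$ implies $\sum_i\varepsilon_i f''(s_i)\in T_0$ for all finite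 sequences $(s_i)$ in $S$ and signs $\varepsilon_i=\pm1$, with $f'(x+s)=f'(x)+f''(s)$ for all $x\in X$, $s\in S$. Let $\mathbf{Nac}=\mathbf{Act}'/\mathcal R$, where $f\,\mathcal R\,g$ means that $f'=g'$ and $f''(s)-g''(s)\in T_0$ for all $s\in S$; a morphism $[f]$ of $\mathbf{Nac}$ is null if $f'$ is the zero map. Let $P:\mathbf{Act}\to\mathbf{Nac}$ be the functor $(X,S)\mapsto(X,S,\mathrm{Fix}_S(0_X))$, $f\mapsto[f]$. **Semiexact categories.** A semiexact category is a category with an ideal of null morphisms which is closed (every null morphism factorises through an object whose identity is null) and such that every morphism $f$ has a kernel and a cokernel with respect to it (a kernel of $f$ is a morphism $k$ with $fk$ null, such that every $a$ with $fa$ null factorises uniquely through $k$; dually for cokernels). A sequence $(m,p)$ is short exact if $m$ is a kernel of $p$ and $p$ is a cokernel of $m$. A functor between semiexact categories is left exact, right exact, exact, short exact if it preserves, respectively, kernels, cokernels, both, short exact sequences. **Theorem.** The categories $\mathbf{Act}$ and $\mathbf{Nac}$, with the null morphisms above, are semiexact, and the normal subobjects (kernels, up to isomorphism) of each of their objects form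 a small set. The functor $P$ is the category of fractions $\Sigma^{-1}\mathbf{Act}$: it sends every morphism of $\Sigma$ to an isomorphism and, for every category $\mathbf C$ and every functor $G:\mathbf{Act}\to\mathbf C$ sending every morphism of $\Sigma$ to an isomorphism, there is exactly one functor $G':\mathbf{Nac}\to\mathbf C$ with $G'P=G$; moreover $P$ is a localization of $\mathbf{Act}$ at $\Sigma$ in the usual sense (the functor from the constructed category of fractions $\mathbf{Act}[\Sigma^{-1}]$ to $\mathbf{Nac}$ induced by $P$ is an equivalence). Furthermore, $P$ is exact (hence left exact, right exact and short exact) and solves the same universal problem within semiexact categories and exact functors: if $\mathbf C$ is semiexact and $G:\mathbf{Act}\to\mathbf C$ is an exact functor sending every morphism of $\Sigma$ to an isomorphism, there is exactly one exact functor $G':\mathbf{Nac}\to\mathbf C$ with $G'P=G$. The same holds with 'exact' replaced throughout by 'left exact', by 'right exact', or by 'short exact'. -/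

import Mathlib

open CategoryTheory

universe u v w

namespace NormAct

/-! ### Semiexact categories

A semiexact category is a category `C` with a closed ideal `N` of null morphisms, with respect to
which every morphism has a kernel and a cokernel. -/

section Semiexact

variable {C : Type u} [Category.{v} C]

/-- `k` is a kernel of `f` with respect to the class `N` of null morphisms. -/
def IsKer (N : MorphismProperty C) {K A B : C} (k : K ⟶ A) (f : A ⟶ B) : Prop :=
  N (k ≫ f) ∧ ∀ ⦃Z : C⦄ (a : Z ⟶ A), N (a ≫ f) → ∃! b : Z ⟶ K, b ≫ k = a

/-- `c` is a cokernel of `f` with respect to the class `N` of null morphisms. -/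
def IsCok (N : MorphismProperty C) {A B Q : C} (c : B ⟶ Q) (f : A ⟶ B) : Prop :=
  N (f ≫ c) ∧ ∀ ⦃Z : C⦄ (a : B ⟶ Z), N (f ≫ a) → ∃! b : Q ⟶ Z, c ≫ b = a

/-- The category `C`, with `N` as its class of null morphisms, is semiexact: `N` is an ideal, it is
closed (every null morphism factorises through a null identity), and all kernels and cokernels
with respect to `N` exist. No smallness is required here. -/
structure IsSemiexact (N : MorphismProperty C) : Prop where
  null_comp : ∀ {X Y Z : C} (f : X ⟶ Y) (g : Y ⟶ Z), N f → N (f ≫ g)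
  comp_null : ∀ {X Y Z : C} (f : X ⟶ Y) (g : Y ⟶ Z), N g → N (f ≫ g)
  closed : ∀ {X Y : C} (f : X ⟶ Y), N f →
    ∃ (Z : C) (a : X ⟶ Z) (b : Z ⟶ Y), N (𝟙 Z) ∧ a ≫ b = f
  exists_ker : ∀ {X Y : C} (f : X ⟶ Y), ∃ (K : C) (k : K ⟶ X), IsKer N k f
  exists_cok : ∀ {X Y : C} (f : X ⟶ Y), ∃ (Q : C) (c : Y ⟶ Q), IsCok N c f

/-- Normal well-poweredness: the normal subobjects (classes of kernels) of each object form a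
small set, relative to the universe `w`. -/
def NormallyWellPowered (N : MorphismProperty C) : Prop :=
  ∀ A : C, Small.{w} {s : Subobject A // ∃ (B : C) (f : A ⟶ B), IsKer N s.arrow f}

end Semiexact

section ExactFunctors

universe u' v'

variable {C : Type u} [Category.{v} C] {D : Type u'} [Category.{v'} D]

/-- Left exact functors: they preserve kernels. -/
def LeftExact (N : MorphismProperty C) (M : MorphismProperty D) (F : C ⥤ D) : Prop :=
  ∀ ⦃K A B : C⦄ (k : K ⟶ A) (f : A ⟶ B), IsKer N k f → IsKer M (F.map k) (F.map f)

/-- Right exact functors: they preserve cokernels. -/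
def RightExact (N : MorphismProperty C) (M : MorphismProperty D) (F : C ⥤ D) : Prop :=
  ∀ ⦃A B Q : C⦄ (c : B ⟶ Q) (f : A ⟶ B), IsCok N c f → IsCok M (F.map c) (F.map f)

/-- Exact functors: they preserve kernels and cokernels. -/
def Exact (N : MorphismProperty C) (M : MorphismProperty D) (F : C ⥤ D) : Prop :=
  LeftExact N M F ∧ RightExact N M F

/-- Short exact sequences: `m` is a kernel of `p` and `p` is a cokernel of `m`. -/
def IsShortExact (N : MorphismProperty C) {A B Q : C} (m : A ⟶ B) (p : B ⟶ Q) : Prop :=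
  IsKer N m p ∧ IsCok N p m

/-- Short exact functors: they preserve short exact sequences. -/
def ShortExactFunctor (N : MorphismProperty C) (M : MorphismProperty D) (F : C ⥤ D) : Prop :=
  ∀ ⦃A B Q : C⦄ (m : A ⟶ B) (p : B ⟶ Q),
    IsShortExact N m p → IsShortExact M (F.map m) (F.map p)

end ExactFunctors

/-! ### Actions of groups on pointed sets -/

/-- An action: a group `S` (written additively, not assumed commutative) acting on the right on a
set `X` with a base point `pt`. The base point need not be fixed. -/
structure Act where
  X : Type u
  S : Type u
  [grp : AddGroup S]
  pt : X
  act : X → S → X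
  act_zero : ∀ x, act x 0 = x
  act_add : ∀ x s t, act (act x s) t = act x (s + t)

attribute [instance] Act.grp

/-- The subgroup of the operators that leave the base point fixed. -/
def Act.fix (A : Act.{u}) : AddSubgroup A.S where
  carrier := {s | A.act A.pt s = A.pt}
  zero_mem' := A.act_zero _
  add_mem' := by
    intro s t hs ht
    simp only [Set.mem_ofPred_eq] at hs ht ⊢
    rw [← A.act_add, hs, ht]
  neg_mem' := by
    intro s hs
    simp only [Set.mem_ofPred_eq] at hs ⊢
    conv_lhs => rw [← hs]
    rw [A.act_add, add_neg_cancel, A.act_zero]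

/-- A morphism of actions: a map of pointed sets and a consistent homomorphism of groups. -/
@[ext]
structure Act.Hom (A B : Act.{u}) where
  onPts : A.X → B.X
  onOps : A.S →+ B.S
  map_pt : onPts A.pt = B.pt
  map_act : ∀ x s, onPts (A.act x s) = B.act (onPts x) (onOps s)

instance : Category Act.{u} where
  Hom := Act.Hom
  id A := ⟨id, AddMonoidHom.id _, rfl, fun _ _ => rfl⟩
  comp f g := ⟨g.onPts ∘ f.onPts, g.onOps.comp f.onOps,
    by simp [f.map_pt, g.map_pt], by simp [f.map_act, g.map_act]⟩

/-- A morphism of actions is null when its map of pointed sets is the zero map. -/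
def actNull : MorphismProperty Act.{u} :=
  fun _ B (f : Act.Hom _ B) => ∀ x, f.onPts x = B.pt

/-- The action `(X, S/N)`, for an invariant subgroup `N` of `S` that acts trivially on `X`. -/
def Act.quot (A : Act.{u}) (N : AddSubgroup A.S) [N.Normal]
    (hN : ∀ x, ∀ n ∈ N, A.act x n = x) : Act.{u} where
  X := A.X
  S := A.S ⧸ N
  pt := A.pt
  act x := Quotient.lift (A.act x) (by
    intro a b h
    have h' : -a + b ∈ N := QuotientAddGroup.leftRel_apply.mp h
    have := hN (A.act x a) _ h'
    rw [A.act_add, add_neg_cancel_left] at this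
    exact this.symm)
  act_zero x := A.act_zero x
  act_add x := by
    rintro ⟨s⟩ ⟨t⟩
    exact A.act_add x s t

/-- The natural projection `(X, S) ⟶ (X, S/N)`. -/
def Act.proj (A : Act.{u}) (N : AddSubgroup A.S) [N.Normal]
    (hN : ∀ x, ∀ n ∈ N, A.act x n = x) : A ⟶ A.quot N hN :=
  Act.Hom.mk (B := A.quot N hN) id (QuotientAddGroup.mk' N) rfl (fun _ _ => rfl)

/-- The natural projections `(X, S) ⟶ (X, S/N)`, with `N` an invariant subgroup of `S` that acts
trivially on `X`. -/
inductive naturalProj : MorphismProperty Act.{u}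
  | mk (A : Act.{u}) (N : AddSubgroup A.S) [N.Normal] (hN : ∀ x, ∀ n ∈ N, A.act x n = x) :
    naturalProj (A.proj N hN)

/-- The class `Σ`: the morphisms isomorphic (in the category of arrows) to natural projections. -/
def excision : MorphismProperty Act.{u} := naturalProj.isoClosure

/-! ### Quasi-homomorphisms of pairs of groups -/

/-- The evaluation homomorphism from the free group on the underlying set of `S` to `S`. -/
def eval (S : Type u) [AddGroup S] : FreeAddGroup S →+ S := FreeAddGroup.lift id

/-- Quasi-homomorphisms `(S, S₀) → (T, T₀)`: mappings `f` such that `∑ εᵢ sᵢ ∈ S₀` implies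
`∑ εᵢ f sᵢ ∈ T₀`, for all finite additive combinations (`εᵢ = ±1`), where the formal additive
combinations are the elements of the free group on the underlying set of `S`. -/
def IsQuasiHom {S T : Type u} [AddGroup S] [AddGroup T]
    (S₀ : AddSubgroup S) (T₀ : AddSubgroup T) (f : S → T) : Prop :=
  ∀ c : FreeAddGroup S, eval S c ∈ S₀ → eval T (FreeAddGroup.map f c) ∈ T₀

theorem IsQuasiHom.id {S : Type u} [AddGroup S] (S₀ : AddSubgroup S) :
    IsQuasiHom S₀ S₀ (id : S → S) := by
  intro c hc
  simpa using hc

theorem IsQuasiHom.comp {S T U : Type u} [AddGroup S] [AddGroup T] [AddGroup U]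
    {S₀ : AddSubgroup S} {T₀ : AddSubgroup T} {U₀ : AddSubgroup U} {f : S → T} {g : T → U}
    (hg : IsQuasiHom T₀ U₀ g) (hf : IsQuasiHom S₀ T₀ f) : IsQuasiHom S₀ U₀ (g ∘ f) := by
  intro c hc
  have := hg _ (hf c hc)
  rwa [FreeAddGroup.map.comp] at this

theorem IsQuasiHom.of_hom {S T : Type u} [AddGroup S] [AddGroup T]
    {S₀ : AddSubgroup S} {T₀ : AddSubgroup T} (f : S →+ T) (h : ∀ s ∈ S₀, f s ∈ T₀) :
    IsQuasiHom S₀ T₀ f := by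
  intro c hc
  have e : (eval T).comp (FreeAddGroup.map f) = f.comp (eval S) := by
    ext s
    simp [eval]
  have : eval T (FreeAddGroup.map f c) = f (eval S c) := DFunLike.congr_fun e c
  rw [this]
  exact h _ hc

theorem IsQuasiHom.sub_mem {S T : Type u} [AddGroup S] [AddGroup T]
    {S₀ : AddSubgroup S} {T₀ : AddSubgroup T} {f : S → T} (hf : IsQuasiHom S₀ T₀ f)
    {s s' : S} (h : s - s' ∈ S₀) : f s - f s' ∈ T₀ := by
  have := hf (FreeAddGroup.of s - FreeAddGroup.of s') (by simpa [eval] using h)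
  simpa [eval] using this

/-! ### The category `Act'` and the category `Nac` of normalised actions -/

/-- An object of `Act'`: a triple `(X, S, S₀)`, with `(X, S)` an action and `S₀` the subgroup of
the operators that leave the base point fixed. -/
structure Act' where
  toAct : Act.{u}
  S₀ : AddSubgroup toAct.S
  eq_fix : S₀ = toAct.fix

/-- A morphism of `Act'`: a map of pointed sets and a consistent quasi-homomorphism. -/
@[ext]
structure Act'.Hom (A B : Act'.{u}) where
  onPts : A.toAct.X → B.toAct.X
  onOps : A.toAct.S → B.toAct.S
  map_pt : onPts A.toAct.pt = B.toAct.pt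
  quasi : IsQuasiHom A.S₀ B.S₀ onOps
  map_act : ∀ x s, onPts (A.toAct.act x s) = B.toAct.act (onPts x) (onOps s)

instance : Category Act'.{u} where
  Hom := Act'.Hom
  id A := ⟨id, id, rfl, IsQuasiHom.id _, fun _ _ => rfl⟩
  comp f g := ⟨g.onPts ∘ f.onPts, g.onOps ∘ f.onOps,
    by simp [f.map_pt, g.map_pt], g.quasi.comp f.quasi, by simp [f.map_act, g.map_act]⟩

/-- The functor `Act ⥤ Act'`, `(X, S) ↦ (X, S, Fix_S(0_X))`. -/
def toAct' : Act.{u} ⥤ Act'.{u} where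
  obj A := ⟨A, A.fix, rfl⟩
  map {A B} f := Act'.Hom.mk (A := ⟨A, A.fix, rfl⟩) (B := ⟨B, B.fix, rfl⟩)
    (Act.Hom.onPts f) (Act.Hom.onOps f) (Act.Hom.map_pt f)
    (IsQuasiHom.of_hom _ (by
      intro s hs
      change B.act B.pt (Act.Hom.onOps f s) = B.pt
      have hs' : A.act A.pt s = A.pt := hs
      rw [← Act.Hom.map_pt f, ← Act.Hom.map_act f, hs']))
    (Act.Hom.map_act f)

/-- The congruence of `Act'`: `f` and `g` have the same map of pointed sets, and
`f'' s - g'' s ∈ T₀` for all operators `s`. -/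
def nacRel : HomRel Act'.{u} :=
  fun A B (f g : Act'.Hom A B) => f.onPts = g.onPts ∧ ∀ s, f.onOps s - g.onOps s ∈ B.S₀

instance : Congruence nacRel.{u} where
  comp_left := by
    rintro A B D f g g' ⟨h1, h2⟩
    exact ⟨congrArg (· ∘ Act'.Hom.onPts f) h1, fun s => h2 _⟩
  comp_right := by
    rintro A B D f f' g ⟨h1, h2⟩
    exact ⟨congrArg (Act'.Hom.onPts g ∘ ·) h1, fun s => (Act'.Hom.quasi g).sub_mem (h2 s)⟩
  equivalence :=
    { refl := fun f => ⟨rfl, fun s => by simp [zero_mem]⟩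
      symm := fun h => ⟨h.1.symm, fun s => by simpa using neg_mem (h.2 s)⟩
      trans := fun h k => ⟨h.1.trans k.1, fun s => by
        simpa using add_mem (h.2 s) (k.2 s)⟩ }

/-- The category of normalised actions, the quotient of `Act'` modulo the congruence. -/
abbrev Nac := CategoryTheory.Quotient nacRel.{u}

/-- A morphism `[f]` of `Nac` is null when the map of pointed sets of `f` is the zero map. -/
def nacNull : MorphismProperty Nac.{u} :=
  fun A B φ => ∃ f : Act'.Hom A.as B.as,
    (Quotient.functor nacRel).map f = φ ∧ ∀ x, f.onPts x = B.as.toAct.pt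

/-- Nullity in `Nac` does not depend on the choice of a representative. -/
theorem nacNull_map {A B : Act'.{u}} (f : A ⟶ B) :
    nacNull ((Quotient.functor nacRel).map f) ↔ ∀ x, Act'.Hom.onPts f x = B.toAct.pt := by
  constructor
  · rintro ⟨g, hg, h⟩ x
    have := ((Quotient.functor_map_eq_iff nacRel g f).1 hg).1
    rw [← this]
    exact h x
  · exact fun h => ⟨f, rfl, h⟩

/-- The canonical functor `P : Act ⥤ Nac`, `(X, S) ↦ (X, S, Fix_S(0_X))`, `f ↦ [f]`. -/
def P : Act.{u} ⥤ Nac.{u} := toAct' ⋙ Quotient.functor nacRel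

end NormAct

/-! A morphism of `Nac` is the same thing as its map of pointed sets. Representatives `f`, `g` with
the same map `f'` are congruent, since `f''(s)` and `g''(s)` both carry the base point to `f'(0 +
s)`. Conversely, let `g` be a pointed map that is consistent: each operator `s` admits some `t` with
`g(x + s) = g(x) + t` for all `x`. Any choice `s ↦ t` is then automatically a quasi-homomorphism
(`Nac.hom_ext`, `Nac.homMk`).

For such a `g`, the consistent pairs `(s, t)` form a subgroup of `S × T` acting on `X` through `s`.
Its projection to `(X, S)` is bijective on points and surjective on operators, hence lies in `Σ`;
its projection to `(Y, T)` has `g` as map of points. So each morphism of `Nac` is a fraction `P(q)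
P(p)⁻¹` with `p` in `Σ`. This forces the extension `G'` of a functor `G` inverting `Σ`, and also
defines it (`fracMap`). Functoriality rests on `map_comp_fracMap`: every span of actions consistent
with a morphism factors through its graph.

The kernels and cokernels built in `Act` keep their universal properties in `Nac`, because the
factorisations are determined on points. As each arrow of `Nac` is isomorphic to one in the image of
`P`, semiexactness of `Nac` follows, and every exactness property of `P ⋙ G'` passes to `G'`. -/

namespace NormAct

/-! ### Transport of kernels and cokernels along isomorphisms and functors -/

section Squares

variable {C : Type u} [Category.{v} C] {N : MorphismProperty C}

/-- A two-sided ideal of morphisms. -/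
structure IsNullIdeal (N : MorphismProperty C) : Prop where
  null_comp : ∀ {X Y Z : C} (f : X ⟶ Y) (g : Y ⟶ Z), N f → N (f ≫ g)
  comp_null : ∀ {X Y Z : C} (f : X ⟶ Y) (g : Y ⟶ Z), N g → N (f ≫ g)

theorem IsSemiexact.isNullIdeal (h : IsSemiexact N) : IsNullIdeal N :=
  ⟨h.null_comp, h.comp_null⟩

theorem IsKer.of_square (hN : IsNullIdeal N) {K A B K' A' B' : C} {k : K ⟶ A} {f : A ⟶ B}
    {k' : K' ⟶ A'} {f' : A' ⟶ B'} (a : K ⟶ K') (b : A ⟶ A') (c : B ⟶ B') [IsIso a] [IsIso b]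
    [IsIso c] (h₁ : k ≫ b = a ≫ k') (h₂ : f ≫ c = b ≫ f') (h : IsKer N k f) : IsKer N k' f' := by
  obtain rfl : k' = inv a ≫ k ≫ b := by simp [h₁]
  obtain rfl : f' = inv b ≫ f ≫ c := by simp [h₂]
  refine ⟨?_, fun Z z hz => ?_⟩
  · have := hN.comp_null (inv a) _ (hN.null_comp _ c h.1)
    simpa using this
  · obtain ⟨y, hy, hu⟩ := h.2 (z ≫ inv b) (by simpa using hN.null_comp _ (inv c) hz)
    refine ⟨y ≫ a, by simp [reassoc_of% hy], fun y' hy' => ?_⟩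
    rw [← hu (y' ≫ inv a) (by simp [← hy'])]
    simp

theorem IsCok.of_square (hN : IsNullIdeal N) {A B Q A' B' Q' : C} {f : A ⟶ B} {p : B ⟶ Q}
    {f' : A' ⟶ B'} {p' : B' ⟶ Q'} (a : A ⟶ A') (b : B ⟶ B') (c : Q ⟶ Q') [IsIso a] [IsIso b]
    [IsIso c] (h₁ : f ≫ b = a ≫ f') (h₂ : p ≫ c = b ≫ p') (h : IsCok N p f) : IsCok N p' f' := by
  obtain rfl : f' = inv a ≫ f ≫ b := by simp [h₁]
  obtain rfl : p' = inv b ≫ p ≫ c := by simp [h₂]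
  refine ⟨?_, fun Z z hz => ?_⟩
  · have := hN.comp_null (inv a) _ (hN.null_comp _ c h.1)
    simpa using this
  · obtain ⟨y, hy, hu⟩ := h.2 (b ≫ z) (by simpa using hN.comp_null a _ hz)
    refine ⟨inv c ≫ y, by simp [hy], fun y' hy' => ?_⟩
    rw [← hu (c ≫ y') (by simp [← hy'])]
    simp

/-- Two different arrows `f`, `f'` are allowed so that normal subobjects can be compared for
well-poweredness. -/
theorem IsKer.exists_lift {K K' A B B' : C} {k : K ⟶ A} {f : A ⟶ B} {k' : K' ⟶ A} {f' : A ⟶ B'}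
    (h : IsKer N k f) (h' : IsKer N k' f') (hk : N (k ≫ f'))
    (hk' : N (k' ≫ f)) : ∃ a : K ⟶ K', IsIso a ∧ a ≫ k' = k := by
  obtain ⟨a, ha, -⟩ := h'.2 k hk
  obtain ⟨b, hb, -⟩ := h.2 k' hk'
  refine ⟨a, ⟨b, ?_, ?_⟩, ha⟩
  · exact (h.2 k h.1).unique (by simp [ha, hb]) (by simp)
  · exact (h'.2 k' h'.1).unique (by simp [ha, hb]) (by simp)

theorem IsKer.exists_square (hN : IsNullIdeal N) {K A B K' A' B' : C} {k : K ⟶ A} {f : A ⟶ B}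
    {k' : K' ⟶ A'} {f' : A' ⟶ B'} (h : IsKer N k f) (h' : IsKer N k' f') (b : A ⟶ A')
    (c : B ⟶ B') [IsIso b] [IsIso c] (e : f ≫ c = b ≫ f') :
    ∃ a : K ⟶ K', IsIso a ∧ k ≫ b = a ≫ k' := by
  have hk : IsKer N (k ≫ b) f' := h.of_square hN (𝟙 _) b c (by simp) e
  obtain ⟨a, ha, e⟩ := hk.exists_lift h' hk.1 h'.1
  exact ⟨a, ha, e.symm⟩

theorem IsCok.exists_square (hN : IsNullIdeal N) {A B Q A' B' Q' : C} {f : A ⟶ B} {p : B ⟶ Q}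
    {f' : A' ⟶ B'} {p' : B' ⟶ Q'} (h : IsCok N p f) (h' : IsCok N p' f') (a : A ⟶ A')
    (b : B ⟶ B') [IsIso a] [IsIso b] (e : f ≫ b = a ≫ f') :
    ∃ c : Q ⟶ Q', IsIso c ∧ p ≫ c = b ≫ p' := by
  have hp : IsCok N (inv b ≫ p) f' := h.of_square hN a b (𝟙 _) e (by simp)
  obtain ⟨c, hc, -⟩ := hp.2 p' h'.1
  obtain ⟨d, hd, -⟩ := h'.2 _ hp.1
  refine ⟨c, ⟨d, ?_, ?_⟩, by simp [← hc]⟩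
  · exact (hp.2 _ hp.1).unique (by rw [← Category.assoc, hc, hd]) (by simp)
  · exact (h'.2 _ h'.1).unique (by rw [← Category.assoc, hd, hc]) (by simp)

/-- A kernel and its cokernel form a short exact sequence. -/
theorem IsKer.isShortExact (hN : IsNullIdeal N) {K A B Q : C} {k : K ⟶ A} {f : A ⟶ B} {c : A ⟶ Q}
    (h : IsKer N k f) (hc : IsCok N c k) : IsShortExact N k c := by
  obtain ⟨r, rfl, -⟩ := hc.2 f h.1
  exact ⟨⟨hc.1, fun Z z hz => h.2 z (by simpa using hN.null_comp _ r hz)⟩, hc⟩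

/-- If the class of morphisms annihilated by `f : A ⟶ B` depends only on an invariant of `f` with
values in a small set, then the category is normally well-powered. -/
theorem normallyWellPowered_of_invariant {T : C → Type w}
    (κ : ∀ {A B : C}, (A ⟶ B) → T A)
    (h : ∀ {A B B' Z : C} (f : A ⟶ B) (f' : A ⟶ B') (a : Z ⟶ A), κ f = κ f' → N (a ≫ f) →
      N (a ≫ f')) :
    NormallyWellPowered.{u, v, w} N := by
  intro A
  let F : {s : Subobject A // ∃ (B : C) (f : A ⟶ B), IsKer N s.arrow f} → T A :=
    fun s => κ s.2.choose_spec.choose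
  refine small_of_injective (f := F) ?_
  intro s t hst
  have hs := s.2.choose_spec.choose_spec
  have ht := t.2.choose_spec.choose_spec
  obtain ⟨a, ha, e⟩ := hs.exists_lift ht (h _ _ _ hst hs.1) (h _ _ _ hst.symm ht.1)
  exact Subtype.ext (Subobject.eq_of_comm (asIso a) e)

variable {D : Type*} [Category* D] {M : MorphismProperty D}

/-- Kernels are unique up to isomorphism, so testing one kernel per arrow suffices. -/
theorem leftExact_of_exists_isKer (hM : IsNullIdeal M) (F : C ⥤ D)
    (h : ∀ {A B : C} (f : A ⟶ B), ∃ (K : C) (k : K ⟶ A), IsKer N k f ∧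
      IsKer M (F.map k) (F.map f)) : LeftExact N M F := by
  intro K A B k f hk
  obtain ⟨K₀, k₀, h₀, h₁⟩ := h f
  obtain ⟨a, ha, e⟩ := h₀.exists_lift hk h₀.1 hk.1
  exact h₁.of_square hM (F.map a) (𝟙 _) (𝟙 _) (by simp [← F.map_comp, e]) (by simp)

theorem rightExact_of_exists_isCok (hN : IsNullIdeal N) (hM : IsNullIdeal M) (F : C ⥤ D)
    (h : ∀ {A B : C} (f : A ⟶ B), ∃ (Q : C) (c : B ⟶ Q), IsCok N c f ∧
      IsCok M (F.map c) (F.map f)) : RightExact N M F := by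
  intro A B Q c f hc
  obtain ⟨Q₀, c₀, h₀, h₁⟩ := h f
  obtain ⟨a, ha, e⟩ := h₀.exists_square hN hc (𝟙 _) (𝟙 _) (by simp)
  exact h₁.of_square hM (𝟙 _) (𝟙 _) (F.map a) (by simp) (by simp [← F.map_comp, e])

theorem Exact.shortExactFunctor {F : C ⥤ D} (h : Exact N M F) : ShortExactFunctor N M F :=
  fun _ _ _ m p hmp => ⟨h.1 m p hmp.1, h.2 p m hmp.2⟩

/-- Every morphism of the target of `F` is isomorphic to the image of a morphism of the source. -/
def EssSurjOnArrows (F : C ⥤ D) : Prop :=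
  ∀ {A B : D} (f : A ⟶ B), ∃ (A₀ B₀ : C) (f₀ : A₀ ⟶ B₀) (a : F.obj A₀ ⟶ A) (b : F.obj B₀ ⟶ B),
    IsIso a ∧ IsIso b ∧ F.map f₀ ≫ b = a ≫ f

variable {E : Type*} [Category* E] {L : MorphismProperty E} {F : C ⥤ D}

/-- Every kernel in `D` is isomorphic to the image under `F` of a kernel in `C`, where the
hypothesis on `F ⋙ G` applies. -/
theorem LeftExact.of_comp (hF : EssSurjOnArrows F) (hN : IsSemiexact N) (hM : IsNullIdeal M)
    (hL : IsNullIdeal L) (h : LeftExact N M F) {G : D ⥤ E} (hG : LeftExact N L (F ⋙ G)) :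
    LeftExact M L G := by
  intro K A B k f hk
  obtain ⟨A₀, B₀, f₀, a, b, ha, hb, e⟩ := hF f
  obtain ⟨K₀, k₀, h₀⟩ := hN.exists_ker f₀
  obtain ⟨c, hc, e'⟩ := (h _ _ h₀).exists_square hM hk a b e
  exact (hG _ _ h₀).of_square hL (G.map c) (G.map a) (G.map b)
    (by rw [Functor.comp_map, ← G.map_comp, e', G.map_comp]) (by rw [Functor.comp_map, ← G.map_comp, e, G.map_comp])

theorem RightExact.of_comp (hF : EssSurjOnArrows F) (hN : IsSemiexact N) (hM : IsNullIdeal M)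
    (hL : IsNullIdeal L) (h : RightExact N M F) {G : D ⥤ E} (hG : RightExact N L (F ⋙ G)) :
    RightExact M L G := by
  intro A B Q p f hp
  obtain ⟨A₀, B₀, f₀, a, b, ha, hb, e⟩ := hF f
  obtain ⟨Q₀, p₀, h₀⟩ := hN.exists_cok f₀
  obtain ⟨c, hc, e'⟩ := (h _ _ h₀).exists_square hM hp a b e
  exact (hG _ _ h₀).of_square hL (G.map a) (G.map b) (G.map c)
    (by rw [Functor.comp_map, ← G.map_comp, e, G.map_comp]) (by rw [Functor.comp_map, ← G.map_comp, e', G.map_comp])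

theorem ShortExactFunctor.of_comp (hF : EssSurjOnArrows F) (hN : IsSemiexact N)
    (hM : IsNullIdeal M) (hL : IsNullIdeal L) (h : Exact N M F) {G : D ⥤ E}
    (hG : ShortExactFunctor N L (F ⋙ G)) : ShortExactFunctor M L G := by
  intro A B Q m p hmp
  obtain ⟨B₀, Q₀, f₀, a, b, ha, hb, e⟩ := hF p
  obtain ⟨K₀, k₀, hk₀⟩ := hN.exists_ker f₀
  -- The arrow `f₀` lifting `p` need not be a cokernel, so it is replaced by the cokernel of its
  -- kernel; `F` sends this to an arrow isomorphic to `p`.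
  obtain ⟨C₀, c₀, hc₀⟩ := hN.exists_cok k₀
  obtain ⟨i, hi, e₁⟩ := (h.1 _ _ hk₀).exists_square hM hmp.1 a b e
  obtain ⟨j, hj, e₂⟩ := (h.2 _ _ hc₀).exists_square hM hmp.2 i a e₁
  have hs := hG _ _ (hk₀.isShortExact hN.isNullIdeal hc₀)
  have s₁ : (F ⋙ G).map k₀ ≫ G.map a = G.map i ≫ G.map m := by rw [Functor.comp_map, ← G.map_comp, e₁, G.map_comp]
  have s₂ : (F ⋙ G).map c₀ ≫ G.map j = G.map a ≫ G.map p := by rw [Functor.comp_map, ← G.map_comp, e₂, G.map_comp]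
  exact ⟨hs.1.of_square hL _ _ _ s₁ s₂, hs.2.of_square hL _ _ _ s₁ s₂⟩

theorem EssSurjOnArrows.exists_isKer (hF : EssSurjOnArrows F)
    (hM : IsNullIdeal M) (h : ∀ {A B : C} (f : A ⟶ B), ∃ (K : C) (k : K ⟶ A), IsKer N k f ∧
      IsKer M (F.map k) (F.map f)) {A B : D} (f : A ⟶ B) : ∃ (K : D) (k : K ⟶ A), IsKer M k f := by
  obtain ⟨A₀, B₀, f₀, a, b, ha, hb, e⟩ := hF f
  obtain ⟨K₀, k₀, -, h₀⟩ := h f₀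
  exact ⟨_, _, h₀.of_square hM (𝟙 _) a b (Category.id_comp _).symm e⟩

theorem EssSurjOnArrows.exists_isCok (hF : EssSurjOnArrows F)
    (hM : IsNullIdeal M) (h : ∀ {A B : C} (f : A ⟶ B), ∃ (Q : C) (c : B ⟶ Q), IsCok N c f ∧
      IsCok M (F.map c) (F.map f)) {A B : D} (f : A ⟶ B) : ∃ (Q : D) (c : B ⟶ Q), IsCok M c f := by
  obtain ⟨A₀, B₀, f₀, a, b, ha, hb, e⟩ := hF f
  obtain ⟨Q₀, p₀, -, h₀⟩ := h f₀
  exact ⟨_, inv b ≫ F.map p₀, h₀.of_square hM a b (𝟙 _) e (by simp)⟩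

end Squares

end NormAct

namespace NormAct

/-! ### Kernels and cokernels in `Act` -/

theorem Act.ext {A B : Act.{u}} {f g : A ⟶ B} (h₁ : Act.Hom.onPts f = Act.Hom.onPts g)
    (h₂ : Act.Hom.onOps f = Act.Hom.onOps g) : f = g :=
  Act.Hom.ext h₁ h₂

theorem Act.act_neg_act (A : Act.{u}) (x : A.X) (s : A.S) : A.act (A.act x s) (-s) = x := by
  rw [A.act_add, add_neg_cancel, A.act_zero]

theorem Act.act_act_neg (A : Act.{u}) (x : A.X) (s : A.S) : A.act (A.act x (-s)) s = x := by
  rw [A.act_add, neg_add_cancel, A.act_zero]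

theorem actNull_isNullIdeal : IsNullIdeal actNull.{u} where
  null_comp _ g hf x := (congrArg (Act.Hom.onPts g) (hf x)).trans (Act.Hom.map_pt g)
  comp_null _ _ hg _ := hg _

/-- The kernel object of a morphism of actions. -/
def Act.ker {A B : Act.{u}} (f : Act.Hom A B) : Act.{u} where
  X := {x : A.X // f.onPts x = B.pt}
  S := B.fix.comap f.onOps
  pt := ⟨A.pt, f.map_pt⟩
  act x s := ⟨A.act x.1 s.1, by
    rw [f.map_act, x.2]
    exact s.2⟩
  act_zero x := Subtype.ext (A.act_zero _)
  act_add x s t := Subtype.ext (A.act_add _ _ _)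

/-- The kernel of a morphism of actions. -/
def Act.kerι {A B : Act.{u}} (f : Act.Hom A B) : Act.ker f ⟶ A :=
  Act.Hom.mk (A := Act.ker f) (B := A) Subtype.val (B.fix.comap f.onOps).subtype rfl
    (fun _ _ => rfl)

/-- Only a pointed map `g` and one pair of operators are involved, so the argument serves both `Act`
and `Nac`. -/
theorem Act.Hom.mem_fix_of_null {A B Z : Act.{u}} (f : Act.Hom A B) {g : Z.X → A.X}
    (hg : g Z.pt = A.pt) (h : ∀ z, f.onPts (g z) = B.pt) {r : Z.S} {s : A.S}
    (hs : g (Z.act Z.pt r) = A.act (g Z.pt) s) : s ∈ B.fix.comap f.onOps := by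
  change B.act B.pt (f.onOps s) = B.pt
  have := h (Z.act Z.pt r)
  rwa [hs, f.map_act, hg, f.map_pt] at this

theorem Act.isKer_kerι {A B : Act.{u}} (f : A ⟶ B) : IsKer actNull (Act.kerι f) f := by
  refine ⟨fun x => x.2, fun Z a ha => ?_⟩
  refine ⟨Act.Hom.mk (A := Z) (B := Act.ker f) (fun z => ⟨Act.Hom.onPts a z, ha z⟩)
    ((Act.Hom.onOps a).codRestrict _ fun r => Act.Hom.mem_fix_of_null f (Act.Hom.map_pt a) ha
      (Act.Hom.map_act a Z.pt r)) (Subtype.ext (Act.Hom.map_pt a))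
    (fun z r => Subtype.ext (Act.Hom.map_act a z r)), rfl, ?_⟩
  rintro b rfl
  rfl

/-- The relation that generates the equivalence relation defining the cokernel. -/
def Act.cokRel {A B : Act.{u}} (f : Act.Hom A B) (y y' : B.X) : Prop :=
  ∃ x t, y = B.act (f.onPts x) t ∧ y' = B.act B.pt t

/-- The cokernel object of a morphism of actions. -/
def Act.cok {A B : Act.{u}} (f : Act.Hom A B) : Act.{u} where
  X := Quot (Act.cokRel f)
  S := B.S
  pt := Quot.mk _ B.pt
  act q t := Quot.map (fun y => B.act y t) (by
    -- The generating pairs are stable under translation, so the action descends to the quotient.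
    rintro _ _ ⟨x, s, rfl, rfl⟩
    exact ⟨x, s + t, B.act_add _ _ _, B.act_add _ _ _⟩) q
  act_zero := by
    rintro ⟨y⟩
    exact congrArg (Quot.mk _) (B.act_zero y)
  act_add := by
    rintro ⟨y⟩ s t
    exact congrArg (Quot.mk _) (B.act_add y s t)

/-- The cokernel of a morphism of actions. -/
def Act.cokπ {A B : Act.{u}} (f : Act.Hom A B) : B ⟶ Act.cok f :=
  Act.Hom.mk (A := B) (B := Act.cok f) (Quot.mk _) (AddMonoidHom.id _) rfl (fun _ _ => rfl)

theorem Act.cokπ_null {A B : Act.{u}} (f : Act.Hom A B) (x : A.X) :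
    Quot.mk (Act.cokRel f) (f.onPts x) = Quot.mk _ B.pt :=
  Quot.sound ⟨x, 0, (B.act_zero _).symm, (B.act_zero _).symm⟩

theorem Act.cokRel.map_eq {A B Z : Act.{u}} {f : Act.Hom A B} {g : B.X → Z.X}
    (hg : g B.pt = Z.pt) (h : ∀ t, ∃ r, ∀ y, g (B.act y t) = Z.act (g y) r)
    (hf : ∀ x, g (f.onPts x) = Z.pt) {y y' : B.X} (hy : Act.cokRel f y y') : g y = g y' := by
  obtain ⟨x, t, rfl, rfl⟩ := hy
  obtain ⟨r, hr⟩ := h t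
  rw [hr, hr, hf, hg]

theorem Act.isCok_cokπ {A B : Act.{u}} (f : A ⟶ B) : IsCok actNull (Act.cokπ f) f := by
  refine ⟨fun x => Act.cokπ_null f x, fun Z a ha => ?_⟩
  refine ⟨Act.Hom.mk (A := Act.cok f) (B := Z)
    (Quot.lift (Act.Hom.onPts a) fun _ _ => Act.cokRel.map_eq (Act.Hom.map_pt a)
      (fun t => ⟨_, fun y => Act.Hom.map_act a y t⟩) ha)
    (Act.Hom.onOps (A := B) (B := Z) a) (Act.Hom.map_pt (A := B) (B := Z) a) ?_, rfl, ?_⟩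
  · rintro ⟨y⟩ t
    exact Act.Hom.map_act a y t
  · rintro b rfl
    refine Act.ext (funext ?_) rfl
    rintro ⟨y⟩
    rfl

theorem actNull_isSemiexact : IsSemiexact actNull.{u} where
  null_comp := actNull_isNullIdeal.null_comp
  comp_null := actNull_isNullIdeal.comp_null
  closed {A B} f hf := by
    let Z : Act.{u} :=
      { X := PUnit, S := A.S, pt := ⟨⟩, act := fun x _ => x, act_zero := fun _ => rfl,
        act_add := fun _ _ _ => rfl }
    refine ⟨Z, Act.Hom.mk (A := A) (B := Z) (fun _ => ⟨⟩) (AddMonoidHom.id _) rfl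
      (fun _ _ => rfl), Act.Hom.mk (A := Z) (B := B) (fun _ => B.pt)
      (Act.Hom.onOps (A := A) (B := B) f) rfl
      (fun _ s => ?_), fun _ => rfl, Act.ext (funext fun x => (hf x).symm) rfl⟩
    -- Since `f` is null, evaluating it at `A.pt` translated by `s` shows that the image of `s`
    -- fixes `B.pt`.
    exact (hf _).symm.trans ((Act.Hom.map_act f A.pt s).trans (by rw [Act.Hom.map_pt f]))
  exists_ker f := ⟨_, _, Act.isKer_kerι f⟩
  exists_cok f := ⟨_, _, Act.isCok_cokπ f⟩

theorem actNull_normallyWellPowered : NormallyWellPowered.{u + 1, u, u} actNull.{u} := by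
  refine normallyWellPowered_of_invariant (T := fun A => Set A.X)
    (fun {A B} f => {x | Act.Hom.onPts f x = B.pt}) ?_
  intro A B B' Z f f' a h ha z
  have : Act.Hom.onPts a z ∈ {x | Act.Hom.onPts f x = B.pt} := ha z
  rwa [h] at this

/-! ### The morphisms of `Nac` as maps of pointed sets -/

namespace Nac

/-- The map of pointed sets underlying a morphism of `Nac`. -/
noncomputable def onPts {A B : Nac.{u}} (φ : A ⟶ B) : A.as.toAct.X → B.as.toAct.X :=
  Act'.Hom.onPts (Quot.out φ)

/-- The maps of pointed sets such that every operator of the source is consistent with some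
operator of the target. -/
structure IsConsistent {A B : Act.{u}} (g : A.X → B.X) : Prop where
  map_pt : g A.pt = B.pt
  exists_op : ∀ s, ∃ t, ∀ x, g (A.act x s) = B.act (g x) t

theorem onPts_map {A B : Act'.{u}} (f : A ⟶ B) :
    onPts ((CategoryTheory.Quotient.functor nacRel).map f) = Act'.Hom.onPts f :=
  ((Quotient.functor_map_eq_iff nacRel _ f).1 (Quot.out_eq _)).1

theorem onPts_P {A B : Act.{u}} (f : A ⟶ B) : onPts (P.map f) = Act.Hom.onPts f :=
  onPts_map (toAct'.map f)

theorem onPts_id (A : Nac.{u}) : onPts (𝟙 A) = id :=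
  onPts_map (𝟙 A.as)

theorem onPts_comp {A B C : Nac.{u}} (φ : A ⟶ B) (ψ : B ⟶ C) :
    onPts (φ ≫ ψ) = onPts ψ ∘ onPts φ := by
  obtain ⟨f, rfl⟩ := (Quotient.functor nacRel).map_surjective φ
  obtain ⟨g, rfl⟩ := (Quotient.functor nacRel).map_surjective ψ
  rw [← Functor.map_comp]
  simp only [onPts_map]
  rfl

theorem isConsistent_onPts {A B : Nac.{u}} (φ : A ⟶ B) :
    IsConsistent (A := A.as.toAct) (B := B.as.toAct) (onPts φ) :=
  ⟨Act'.Hom.map_pt _, fun s => ⟨_, fun x => Act'.Hom.map_act _ x s⟩⟩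

/-- The operator parts of two representatives move the base point alike, so their difference fixes
it: this is the congruence. -/
theorem hom_ext {A B : Nac.{u}} {φ ψ : A ⟶ B} (h : onPts φ = onPts ψ) : φ = ψ := by
  obtain ⟨f, rfl⟩ := (Quotient.functor nacRel).map_surjective φ
  obtain ⟨g, rfl⟩ := (Quotient.functor nacRel).map_surjective ψ
  rw [onPts_map, onPts_map] at h
  refine CategoryTheory.Quotient.sound _ ⟨h, fun s => ?_⟩
  rw [B.as.eq_fix, sub_eq_add_neg]
  change B.as.toAct.act _ _ = _
  rw [← B.as.toAct.act_add, ← Act'.Hom.map_pt f, ← Act'.Hom.map_act f, h, Act'.Hom.map_act g,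
    Act.act_neg_act]

theorem map_act_eval {A B : Act.{u}} {g : A.X → B.X} {σ : A.S → B.S}
    (h : ∀ x s, g (A.act x s) = B.act (g x) (σ s)) (c : FreeAddGroup A.S) (x : A.X) :
    g (A.act x (eval A.S c)) = B.act (g x) (eval B.S (FreeAddGroup.map σ c)) := by
  induction c using FreeAddGroup.induction_on generalizing x with
  | C1 => simp [A.act_zero, B.act_zero]
  | of s => simpa [eval] using h x s
  | neg_of s _ =>
    -- Consistency with `-s` at `x` comes from consistency with `s` at the translate of `x` by `-s`.
    have := h (A.act x (-s)) s
    rw [A.act_act_neg] at this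
    simp [eval, this, B.act_neg_act]
  | add c d hc hd => rw [map_add, map_add, map_add, ← A.act_add, hd, hc, B.act_add]

/-- The morphism of `Nac` given by a consistent map of pointed sets. -/
noncomputable def homMk {A B : Nac.{u}} (g : A.as.toAct.X → B.as.toAct.X)
    (hg : IsConsistent (A := A.as.toAct) (B := B.as.toAct) g) : A ⟶ B :=
  (Quotient.functor nacRel).map (X := A.as) (Y := B.as)
    -- The operators are chosen arbitrarily. If a formal sum evaluates to an operator fixing the
    -- base point, `map_act_eval` shows that the sum of the chosen operators fixes its image.
    (Act'.Hom.mk g (fun s => (hg.exists_op s).choose) hg.map_pt (by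
      intro c hc
      rw [A.as.eq_fix] at hc
      rw [B.as.eq_fix]
      have := map_act_eval (fun x s => (hg.exists_op s).choose_spec x) c A.as.toAct.pt
      rw [hg.map_pt] at this
      exact this.symm.trans ((congrArg g hc).trans hg.map_pt))
      (fun x s => (hg.exists_op s).choose_spec x))

theorem onPts_homMk {A B : Nac.{u}} (g : A.as.toAct.X → B.as.toAct.X)
    (hg : IsConsistent (A := A.as.toAct) (B := B.as.toAct) g) : onPts (homMk g hg) = g :=
  onPts_map _

theorem null_iff {A B : Nac.{u}} (φ : A ⟶ B) :
    nacNull φ ↔ ∀ x, onPts φ x = B.as.toAct.pt := by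
  obtain ⟨f, rfl⟩ := (Quotient.functor nacRel).map_surjective φ
  rw [onPts_map]
  exact nacNull_map f

theorem isIso_of_bijective {A B : Nac.{u}} (φ : A ⟶ B) (h : Function.Bijective (onPts φ))
    (hs : ∀ t, ∃ s, ∀ x, onPts φ (A.as.toAct.act x s) = B.as.toAct.act (onPts φ x) t) :
    IsIso φ := by
  let e := Equiv.ofBijective _ h
  have he : IsConsistent (A := B.as.toAct) (B := A.as.toAct) e.symm := by
    refine ⟨e.symm_apply_eq.2 (isConsistent_onPts φ).map_pt.symm, fun t => ?_⟩
    obtain ⟨s, hs⟩ := hs t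
    refine ⟨s, fun y => e.symm_apply_eq.2 ?_⟩
    rw [Equiv.ofBijective_apply, hs]
    exact congrArg (B.as.toAct.act · t) (e.apply_symm_apply y).symm
  refine ⟨homMk (A := B) (B := A) e.symm he, hom_ext ?_, hom_ext ?_⟩
  · rw [onPts_comp, onPts_homMk, onPts_id]
    exact funext e.symm_apply_apply
  · rw [onPts_comp, onPts_homMk, onPts_id]
    exact funext e.apply_symm_apply

theorem null_isNullIdeal : IsNullIdeal nacNull.{u} where
  null_comp f g hf := by
    rw [null_iff] at hf ⊢
    intro x
    rw [onPts_comp, Function.comp_apply, hf]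
    exact (isConsistent_onPts g).map_pt
  comp_null f g hg := by
    rw [null_iff] at hg ⊢
    intro x
    rw [onPts_comp]
    exact hg _

theorem isKer_map_kerι {A B : Act.{u}} (f : A ⟶ B) :
    IsKer nacNull (P.map (Act.kerι f)) (P.map f) := by
  refine ⟨?_, fun Z a ha => ?_⟩
  · rw [← P.map_comp, null_iff, onPts_P]
    exact (Act.isKer_kerι f).1
  · rw [null_iff, onPts_comp, onPts_P] at ha
    have hc := isConsistent_onPts a
    refine ⟨homMk (A := Z) (B := P.obj (Act.ker f)) (fun z => ⟨onPts a z, ha z⟩)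
      ⟨Subtype.ext hc.map_pt, fun r => ?_⟩, hom_ext ?_, fun b hb => hom_ext ?_⟩
    · obtain ⟨s, hs⟩ := hc.exists_op r
      exact ⟨⟨s, Act.Hom.mem_fix_of_null f hc.map_pt ha (hs _)⟩, fun z => Subtype.ext (hs z)⟩
    · rw [onPts_comp, onPts_P]
      exact congrArg (fun h : Z.as.toAct.X → (P.obj (Act.ker f)).as.toAct.X =>
        Act.Hom.onPts (Act.kerι f) ∘ h) (onPts_homMk _ _)
    · refine Eq.trans ?_ (onPts_homMk _ _).symm
      subst hb
      funext z
      refine Subtype.ext ?_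
      change _ = onPts (b ≫ P.map (Act.kerι f)) z
      rw [onPts_comp, onPts_P]
      rfl

theorem isCok_map_cokπ {A B : Act.{u}} (f : A ⟶ B) :
    IsCok nacNull (P.map (Act.cokπ f)) (P.map f) := by
  refine ⟨?_, fun Z a ha => ?_⟩
  · rw [← P.map_comp, null_iff, onPts_P]
    exact (Act.isCok_cokπ f).1
  · rw [null_iff, onPts_comp, onPts_P] at ha
    have hc := isConsistent_onPts a
    refine ⟨homMk (A := P.obj (Act.cok f)) (B := Z)
      (Quot.lift (onPts a) fun _ _ => Act.cokRel.map_eq hc.map_pt hc.exists_op ha)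
      ⟨hc.map_pt, fun t => ?_⟩, hom_ext ?_, fun b hb => hom_ext ?_⟩
    · obtain ⟨r, hr⟩ := hc.exists_op t
      refine ⟨r, ?_⟩
      rintro ⟨y⟩
      exact hr y
    · rw [onPts_comp, onPts_P]
      exact congrArg (fun h : (P.obj (Act.cok f)).as.toAct.X → Z.as.toAct.X =>
        h ∘ Act.Hom.onPts (Act.cokπ f)) (onPts_homMk _ _)
    · refine Eq.trans ?_ (onPts_homMk _ _).symm
      subst hb
      funext z
      obtain ⟨y, rfl⟩ := Quot.exists_rep z
      change _ = onPts (P.map (Act.cokπ f) ≫ b) y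
      rw [onPts_comp, onPts_P]
      rfl

theorem null_normallyWellPowered : NormallyWellPowered.{u + 1, u, u} nacNull.{u} := by
  refine normallyWellPowered_of_invariant (T := fun A => Set A.as.toAct.X)
    (fun {A B} f => {x | onPts f x = B.as.toAct.pt}) ?_
  intro A B B' Z f f' a h ha
  rw [null_iff, onPts_comp] at ha ⊢
  intro z
  have : onPts a z ∈ {x | onPts f x = B.as.toAct.pt} := ha z
  rwa [h] at this

end Nac

/-! ### Fractions -/

theorem P_inverts_excision : excision.{u}.IsInvertedBy P.{u} := by
  refine (MorphismProperty.IsInvertedBy.isoClosure_iff _ _).2 ?_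
  rintro _ _ _ ⟨A, N, hN⟩
  refine Nac.isIso_of_bijective _ ?_ ?_
  · rw [Nac.onPts_P]
    exact Function.bijective_id
  · rw [Nac.onPts_P]
    rintro ⟨s⟩
    exact ⟨s, fun x => rfl⟩

/-- Injectivity on points makes the kernel of the operator part act trivially; the first isomorphism
theorem then identifies `f` with the projection modulo that kernel. -/
theorem excision_of_bijective_of_surjective {A B : Act.{u}} (f : A ⟶ B)
    (h₁ : Function.Bijective (Act.Hom.onPts f)) (h₂ : Function.Surjective (Act.Hom.onOps f)) :
    excision f := by
  have hN : ∀ x, ∀ n ∈ (Act.Hom.onOps f).ker, A.act x n = x := by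
    intro x n hn
    apply h₁.1
    rw [Act.Hom.map_act, AddMonoidHom.mem_ker.1 hn, B.act_zero]
  let e := Equiv.ofBijective _ h₁
  let d := QuotientAddGroup.quotientKerEquivOfSurjective _ h₂
  have hd : ∀ s, d (QuotientAddGroup.mk s) = Act.Hom.onOps f s := fun s => rfl
  let i : A.quot _ hN ≅ B :=
    { hom := Act.Hom.mk (A := A.quot _ hN) (B := B) (Act.Hom.onPts (A := A) (B := B) f)
        d.toAddMonoidHom (Act.Hom.map_pt (A := A) (B := B) f) (by
          rintro x ⟨s⟩
          exact Act.Hom.map_act f x s)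
      inv := Act.Hom.mk (A := B) (B := A.quot _ hN) e.symm d.symm.toAddMonoidHom
        (e.symm_apply_eq.2 (Act.Hom.map_pt f).symm) (by
          intro y t
          obtain ⟨s, rfl⟩ := h₂ t
          obtain ⟨x, rfl⟩ := h₁.2 y
          have hs : d.symm (Act.Hom.onOps f s) = QuotientAddGroup.mk s :=
            d.symm_apply_eq.2 (hd s).symm
          have hx : e.symm (Act.Hom.onPts f x) = x := e.symm_apply_apply x
          change e.symm _ = (A.quot _ hN).act (e.symm _) (d.symm _)
          rw [hs, hx, ← Act.Hom.map_act f]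
          exact e.symm_apply_apply _)
      hom_inv_id := Act.ext (funext e.symm_apply_apply)
        (AddMonoidHom.ext d.symm_apply_apply)
      inv_hom_id := Act.ext (funext e.apply_symm_apply)
        (AddMonoidHom.ext d.apply_symm_apply) }
  exact ⟨_, _, A.proj _ hN, ⟨A, _, hN⟩,
    ⟨Arrow.isoMk (Iso.refl A) i (by exact Act.ext rfl rfl)⟩⟩

/-! ### The graph of a consistent map -/

section Graph

variable {A B C : Act.{u}}

/-- The action on the source of a consistent map `g` of the group of the consistent pairs of
operators. -/
def graph (A B : Act.{u}) (g : A.X → B.X) : Act.{u} where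
  X := A.X
  S := ({ carrier := {p | ∀ x, g (A.act x p.1) = B.act (g x) p.2}
          zero_mem' := fun x => by simp [A.act_zero, B.act_zero]
          add_mem' := fun {p q} hp hq x => by
            rw [Prod.fst_add, Prod.snd_add, ← A.act_add, hq, hp, B.act_add]
          neg_mem' := fun {p} hp x => by
            have := hp (A.act x (-p.1))
            rw [A.act_act_neg] at this
            rw [Prod.fst_neg, Prod.snd_neg, this, B.act_neg_act] } : AddSubgroup (A.S × B.S))
  pt := A.pt
  act x p := A.act x p.1.1
  act_zero x := A.act_zero x
  act_add x p q := A.act_add x _ _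

/-- The projection of the graph on the source. -/
def graphFst (A B : Act.{u}) (g : A.X → B.X) : graph A B g ⟶ A :=
  Act.Hom.mk (A := graph A B g) (B := A) id
    ((AddMonoidHom.fst A.S B.S).comp (AddSubgroup.subtype _)) rfl (fun _ _ => rfl)

/-- The projection of the graph on the target. -/
def graphSnd {g : A.X → B.X} (hg : g A.pt = B.pt) : graph A B g ⟶ B :=
  Act.Hom.mk (A := graph A B g) (B := B) g
    ((AddMonoidHom.snd A.S B.S).comp (AddSubgroup.subtype _)) hg (fun x p => p.2 x)

theorem excision_graphFst {g : A.X → B.X} (hg : Nac.IsConsistent g) :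
    excision (graphFst A B g) := by
  refine excision_of_bijective_of_surjective _ Function.bijective_id fun s => ?_
  obtain ⟨t, ht⟩ := hg.exists_op s
  exact ⟨⟨(s, t), ht⟩, rfl⟩

/-- A morphism into the graph. -/
def graphLift {D : Act.{u}} (u : D ⟶ A) (h : D ⟶ B) (g : A.X → B.X)
    (hS : ∀ s x, g (A.act x (Act.Hom.onOps u s)) = B.act (g x) (Act.Hom.onOps h s)) :
    D ⟶ graph A B g :=
  Act.Hom.mk (A := D) (B := graph A B g) (Act.Hom.onPts (A := D) (B := A) u)
    (((Act.Hom.onOps (A := D) (B := A) u).prod (Act.Hom.onOps h)).codRestrict _ hS)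
    (Act.Hom.map_pt (A := D) (B := A) u) (Act.Hom.map_act (A := D) (B := A) u)

end Graph

end NormAct

/-! ### Semiexactness of `Nac`, exactness of `P`, and the extension of functors -/

namespace NormAct

/-- Up to isomorphisms that are the identity on points, `φ` is the image of the second projection of
its graph. -/
theorem P_essSurjOnArrows : EssSurjOnArrows P.{u} := by
  intro A B φ
  have hφ := Nac.isConsistent_onPts φ
  have hA : Nac.IsConsistent (A := graph A.as.toAct B.as.toAct (Nac.onPts φ)) (B := A.as.toAct) id :=
    ⟨rfl, fun s => ⟨s.1.1, fun _ => rfl⟩⟩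
  have hB : Nac.IsConsistent (A := B.as.toAct) (B := B.as.toAct) id :=
    ⟨rfl, fun s => ⟨s, fun _ => rfl⟩⟩
  let a := Nac.homMk (A := P.obj (graph A.as.toAct B.as.toAct (Nac.onPts φ))) (B := A) id hA
  let b := Nac.homMk (A := P.obj B.as.toAct) (B := B) id hB
  have ha : Nac.onPts a = id := Nac.onPts_homMk _ _
  have hb : Nac.onPts b = id := Nac.onPts_homMk _ _
  refine ⟨_, _, graphSnd hφ.map_pt, a, b, ?_, ?_, Nac.hom_ext ?_⟩
  · refine Nac.isIso_of_bijective _ (ha ▸ Function.bijective_id) fun t => ?_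
    obtain ⟨r, hr⟩ := hφ.exists_op t
    rw [ha]
    exact ⟨⟨(t, r), hr⟩, fun _ => rfl⟩
  · refine Nac.isIso_of_bijective _ (hb ▸ Function.bijective_id) fun t => ?_
    rw [hb]
    exact ⟨t, fun _ => rfl⟩
  · rw [Nac.onPts_comp, Nac.onPts_comp, ha, hb, Nac.onPts_P]
    rfl

theorem Nac.null_isSemiexact : IsSemiexact nacNull.{u} where
  null_comp := null_isNullIdeal.null_comp
  comp_null := null_isNullIdeal.comp_null
  closed {A B} φ hφ := by
    obtain ⟨A₀, B₀, f, a, b, ha, hb, e⟩ := P_essSurjOnArrows φ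
    have hf : actNull f := by
      have : nacNull (P.map f) := by
        have := null_isNullIdeal.null_comp _ (inv b) (null_isNullIdeal.comp_null a _ hφ)
        rwa [← e, Category.assoc, IsIso.hom_inv_id, Category.comp_id] at this
      rw [null_iff, onPts_P] at this
      exact this
    obtain ⟨Z, x, y, hZ, rfl⟩ := actNull_isSemiexact.closed f hf
    refine ⟨P.obj Z, inv a ≫ P.map x, P.map y ≫ b, ?_, ?_⟩
    · rw [← P.map_id, null_iff, onPts_P]
      exact hZ
    · rw [Category.assoc, ← Category.assoc (P.map x), ← P.map_comp, e, IsIso.inv_hom_id_assoc]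
  exists_ker := P_essSurjOnArrows.exists_isKer null_isNullIdeal
    fun f => ⟨_, _, Act.isKer_kerι f, Nac.isKer_map_kerι f⟩
  exists_cok := P_essSurjOnArrows.exists_isCok null_isNullIdeal
    fun f => ⟨_, _, Act.isCok_cokπ f, Nac.isCok_map_cokπ f⟩

theorem P_exact : Exact actNull nacNull P.{u} :=
  ⟨leftExact_of_exists_isKer Nac.null_isNullIdeal P
      fun f => ⟨_, _, Act.isKer_kerι f, Nac.isKer_map_kerι f⟩,
    rightExact_of_exists_isCok actNull_isNullIdeal Nac.null_isNullIdeal P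
      fun f => ⟨_, _, Act.isCok_cokπ f, Nac.isCok_map_cokπ f⟩⟩

section Lift

variable {C : Type w} [Category.{v} C] {G : Act.{u} ⥤ C}

theorem isIso_map_graphFst (hG : excision.IsInvertedBy G) {X Y : Nac.{u}} (φ : X ⟶ Y) :
    IsIso (G.map (graphFst X.as.toAct Y.as.toAct (Nac.onPts φ))) :=
  hG _ (excision_graphFst (Nac.isConsistent_onPts φ))

/-- The value on a morphism of `Nac` of the extension of a functor that inverts `Σ`. -/
noncomputable def fracMap (hG : excision.IsInvertedBy G) {X Y : Nac.{u}} (φ : X ⟶ Y) :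
    G.obj X.as.toAct ⟶ G.obj Y.as.toAct :=
  haveI := isIso_map_graphFst hG φ
  inv (G.map (graphFst X.as.toAct Y.as.toAct (Nac.onPts φ))) ≫
    G.map (graphSnd (Nac.isConsistent_onPts φ).map_pt)

theorem map_graphFst_comp_fracMap (hG : excision.IsInvertedBy G) {X Y : Nac.{u}} (φ : X ⟶ Y) :
    G.map (graphFst X.as.toAct Y.as.toAct (Nac.onPts φ)) ≫ fracMap hG φ =
      G.map (graphSnd (Nac.isConsistent_onPts φ).map_pt) := by
  have := isIso_map_graphFst hG φ
  simp [fracMap]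

/-- The span `(u, h)` factors through the graph of `φ`. The leg `u` need not lie in `Σ`. -/
theorem map_comp_fracMap (hG : excision.IsInvertedBy G) {X Y : Nac.{u}} (φ : X ⟶ Y)
    {D : Act.{u}} (u : D ⟶ X.as.toAct) (h : D ⟶ Y.as.toAct)
    (e : ∀ x, Nac.onPts φ (Act.Hom.onPts u x) = Act.Hom.onPts h x)
    (hS : ∀ s x, Nac.onPts φ (X.as.toAct.act x (Act.Hom.onOps u s)) =
      Y.as.toAct.act (Nac.onPts φ x) (Act.Hom.onOps h s)) :
    G.map u ≫ fracMap hG φ = G.map h := by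
  have h₁ : graphLift u h _ hS ≫ graphFst _ _ _ = u := Act.ext rfl rfl
  have h₂ : graphLift u h _ hS ≫ graphSnd (Nac.isConsistent_onPts φ).map_pt = h :=
    Act.ext (funext e) rfl
  rw [← h₂, G.map_comp, ← map_graphFst_comp_fracMap hG, ← Category.assoc, ← G.map_comp, h₁]

theorem fracMap_eq_map (hG : excision.IsInvertedBy G) {X Y : Nac.{u}} (φ : X ⟶ Y)
    (f : X.as.toAct ⟶ Y.as.toAct) (h : Nac.onPts φ = Act.Hom.onPts f) :
    fracMap hG φ = G.map f := by
  have := map_comp_fracMap hG φ (𝟙 _) f (fun x => congrFun h x)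
    (fun s x => by rw [h]; exact Act.Hom.map_act f x s)
  rwa [G.map_id, Category.id_comp] at this

/-- Both sides compute the extension of `G` at the single morphism `P.map f`. -/
theorem map_eq_of_onPts_eq (hG : excision.IsInvertedBy G) {A B : Act.{u}} {f g : A ⟶ B}
    (h : Act.Hom.onPts f = Act.Hom.onPts g) : G.map f = G.map g :=
  (fracMap_eq_map hG (P.map f) f (Nac.onPts_P f)).symm.trans
    (fracMap_eq_map hG (P.map f) g ((Nac.onPts_P f).trans h))

theorem fracMap_comp (hG : excision.IsInvertedBy G) {X Y Z : Nac.{u}} (φ : X ⟶ Y) (ψ : Y ⟶ Z) :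
    fracMap hG (φ ≫ ψ) = fracMap hG φ ≫ fracMap hG ψ := by
  have hφ := Nac.isConsistent_onPts φ
  have hψ := Nac.isConsistent_onPts ψ
  let Γ := graph X.as.toAct Y.as.toAct (Nac.onPts φ)
  let Γ' := graph Y.as.toAct Z.as.toAct (Nac.onPts ψ)
  -- The graph of `φ`, viewed as a map between the two graphs, gives a common roof for composing the
  -- fractions.
  have hc : Nac.IsConsistent (A := Γ) (B := Γ') (Nac.onPts φ) := by
    refine ⟨hφ.map_pt, fun s => ?_⟩
    obtain ⟨r, hr⟩ := hψ.exists_op s.1.2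
    exact ⟨⟨(s.1.2, r), hr⟩, s.2⟩
  let p := graphFst Γ Γ' (Nac.onPts φ)
  let q : graph Γ Γ' (Nac.onPts φ) ⟶ Γ' := graphSnd hc.map_pt
  have : IsIso (G.map p) := hG _ (excision_graphFst hc)
  have := isIso_map_graphFst hG φ
  let a := graphFst X.as.toAct Y.as.toAct (Nac.onPts φ)
  let b : Γ ⟶ Y.as.toAct := graphSnd hφ.map_pt
  let c := graphFst Y.as.toAct Z.as.toAct (Nac.onPts ψ)
  let d : Γ' ⟶ Z.as.toAct := graphSnd hψ.map_pt
  have h₁ : G.map p ≫ G.map a ≫ fracMap hG (φ ≫ ψ) = G.map q ≫ G.map d := by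
    rw [← Category.assoc, ← G.map_comp, ← G.map_comp]
    refine map_comp_fracMap hG _ _ _ (fun x => ?_) (fun s x => ?_)
    · rw [Nac.onPts_comp]
      rfl
    · rw [Nac.onPts_comp]
      exact (congrArg (Nac.onPts ψ) (s.2 x)).trans (s.1.2.2 _)
  -- This square commutes in `Act` only on points: its two sides may yield different operators of
  -- `Y`, both consistent with the same operator of `X`. Applying `G` removes the difference.
  have h₂ : G.map p ≫ G.map b = G.map q ≫ G.map c := by
    rw [← G.map_comp, ← G.map_comp]
    exact map_eq_of_onPts_eq hG rfl
  rw [← cancel_epi (G.map a), ← cancel_epi (G.map p), h₁, ← Category.assoc (G.map a),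
    map_graphFst_comp_fracMap, ← Category.assoc (G.map p), h₂, Category.assoc,
    map_graphFst_comp_fracMap]

/-- The extension to `Nac` of a functor that inverts `Σ`. -/
noncomputable def nacLift (G : Act.{u} ⥤ C) (hG : excision.IsInvertedBy G) : Nac.{u} ⥤ C where
  obj X := G.obj X.as.toAct
  map φ := fracMap hG φ
  map_id X := (fracMap_eq_map hG (𝟙 X) (𝟙 _) (Nac.onPts_id X)).trans (G.map_id _)
  map_comp := fracMap_comp hG

theorem P_comp_nacLift (hG : excision.IsInvertedBy G) : P ⋙ nacLift G hG = G :=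
  CategoryTheory.Functor.ext (fun _ => rfl) fun _ _ f =>
    (fracMap_eq_map hG (P.map f) f (Nac.onPts_P f)).trans
      ((Category.id_comp _).trans (Category.comp_id (G.map f))).symm

/-- Strict surjectivity on objects is what makes extensions unique on the nose. -/
theorem exists_P_obj_eq (X : Nac.{u}) : ∃ A, P.obj A = X := by
  obtain ⟨⟨A, S₀, rfl⟩⟩ := X
  exact ⟨A, rfl⟩

theorem exists_fraction {A B : Act.{u}} (φ : P.obj A ⟶ P.obj B) :
    ∃ (D : Act.{u}) (p : D ⟶ A) (q : D ⟶ B), excision p ∧ P.map p ≫ φ = P.map q := by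
  have hφ := Nac.isConsistent_onPts φ
  refine ⟨_, graphFst A B (Nac.onPts φ), graphSnd hφ.map_pt, excision_graphFst hφ,
    Nac.hom_ext ?_⟩
  rw [Nac.onPts_comp, Nac.onPts_P]
  exact (Nac.onPts_P (graphSnd (A := A) (B := B) hφ.map_pt)).symm

theorem eq_of_P_comp_eq {H H' : Nac.{u} ⥤ C} (h : P ⋙ H = P ⋙ H') : H = H' := by
  have ho : ∀ X, H.obj X = H'.obj X := by
    intro X
    obtain ⟨A, rfl⟩ := exists_P_obj_eq X
    exact Functor.congr_obj h A
  refine CategoryTheory.Functor.ext ho fun X Y φ => ?_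
  obtain ⟨A, rfl⟩ := exists_P_obj_eq X
  obtain ⟨B, rfl⟩ := exists_P_obj_eq Y
  obtain ⟨D, p, q, hp, e⟩ := exists_fraction φ
  have : IsIso (P.map p) := P_inverts_excision _ hp
  have h₁ := Functor.congr_hom h p
  have h₂ := Functor.congr_hom h q
  rw [Functor.comp_map, Functor.comp_map] at h₁ h₂
  rw [← cancel_epi (H.map (P.map p)), ← H.map_comp, e, h₂, h₁, ← e]
  simp

/-- Uniqueness already holds among all functors, so each exactness variant only requires that the
extension inherit the property `p`. -/
theorem existsUnique_lift (hG : excision.IsInvertedBy G) (p : (Nac.{u} ⥤ C) → Prop)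
    (h : ∀ H : Nac.{u} ⥤ C, P ⋙ H = G → p H) : ∃! G' : Nac.{u} ⥤ C, p G' ∧ P ⋙ G' = G :=
  ⟨nacLift G hG, ⟨h _ (P_comp_nacLift hG), P_comp_nacLift hG⟩,
    fun _ hH => eq_of_P_comp_eq (hH.2.trans (P_comp_nacLift hG).symm)⟩

/-- The strict universal property of `P`. -/
noncomputable def strictUniversalPropertyP :
    Localization.StrictUniversalPropertyFixedTarget P.{u} excision C where
  inverts := P_inverts_excision
  lift := nacLift
  fac _ hG := P_comp_nacLift hG
  uniq _ _ := eq_of_P_comp_eq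

end Lift

end NormAct

/-- The functor `P : Act ⥤ Nac` is the category of fractions of `Act` with respect to `Σ`: it
inverts `Σ`, and it is universal for that among all categories and functors; moreover, `P` is
exact, and it is universal for that within semiexact categories and exact (or left exact, or right
exact, or short exact) functors. -/
theorem theorem6p5 :
    -- `Act` and `Nac` are semiexact (and normally well-powered) categories
    (NormAct.IsSemiexact NormAct.actNull.{u} ∧
      NormAct.NormallyWellPowered.{u + 1, u, u} NormAct.actNull.{u}) ∧
    (NormAct.IsSemiexact NormAct.nacNull.{u} ∧
      NormAct.NormallyWellPowered.{u + 1, u, u} NormAct.nacNull.{u}) ∧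
    -- `P` inverts `Σ`, and is a localization in the sense of Mathlib
    NormAct.excision.{u}.IsInvertedBy NormAct.P.{u} ∧
    NormAct.P.{u}.IsLocalization NormAct.excision.{u} ∧
    -- the universal property among arbitrary categories and functors
    (∀ (C : Type w) [Category.{v} C] (G : NormAct.Act.{u} ⥤ C),
      NormAct.excision.{u}.IsInvertedBy G →
        ∃! G' : NormAct.Nac.{u} ⥤ C, NormAct.P.{u} ⋙ G' = G) ∧
    -- `P` is exact (in particular left exact, right exact and short exact)
    NormAct.Exact NormAct.actNull.{u} NormAct.nacNull.{u} NormAct.P.{u} ∧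
    NormAct.ShortExactFunctor NormAct.actNull.{u} NormAct.nacNull.{u} NormAct.P.{u} ∧
    -- the universal property within semiexact categories
    (∀ (C : Type w) [Category.{v} C] (M : MorphismProperty C), NormAct.IsSemiexact M →
      ∀ G : NormAct.Act.{u} ⥤ C, NormAct.excision.{u}.IsInvertedBy G →
        (NormAct.Exact NormAct.actNull.{u} M G →
          ∃! G' : NormAct.Nac.{u} ⥤ C,
            NormAct.Exact NormAct.nacNull.{u} M G' ∧ NormAct.P.{u} ⋙ G' = G) ∧
        (NormAct.LeftExact NormAct.actNull.{u} M G →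
          ∃! G' : NormAct.Nac.{u} ⥤ C,
            NormAct.LeftExact NormAct.nacNull.{u} M G' ∧ NormAct.P.{u} ⋙ G' = G) ∧
        (NormAct.RightExact NormAct.actNull.{u} M G →
          ∃! G' : NormAct.Nac.{u} ⥤ C,
            NormAct.RightExact NormAct.nacNull.{u} M G' ∧ NormAct.P.{u} ⋙ G' = G) ∧
        (NormAct.ShortExactFunctor NormAct.actNull.{u} M G →
          ∃! G' : NormAct.Nac.{u} ⥤ C,
            NormAct.ShortExactFunctor NormAct.nacNull.{u} M G' ∧ NormAct.P.{u} ⋙ G' = G)) := by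
  open NormAct in
  refine ⟨⟨actNull_isSemiexact, actNull_normallyWellPowered⟩,
    ⟨Nac.null_isSemiexact, Nac.null_normallyWellPowered⟩, P_inverts_excision,
    -- The strict universal property is used for two targets: `Nac` and the constructed category of
    -- fractions.
    Functor.IsLocalization.mk' _ _ strictUniversalPropertyP strictUniversalPropertyP,
    fun C _ G hG => ⟨nacLift G hG, P_comp_nacLift hG,
      fun H hH => eq_of_P_comp_eq (hH.trans (P_comp_nacLift hG).symm)⟩,
    P_exact, P_exact.shortExactFunctor, ?_⟩
  intro C _ M hM G hG
  have hL (H : Nac ⥤ C) (e : P ⋙ H = G) (h : LeftExact actNull M G) : LeftExact nacNull M H :=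
    LeftExact.of_comp P_essSurjOnArrows actNull_isSemiexact Nac.null_isNullIdeal hM.isNullIdeal
      P_exact.1 (e ▸ h)
  have hR (H : Nac ⥤ C) (e : P ⋙ H = G) (h : RightExact actNull M G) : RightExact nacNull M H :=
    RightExact.of_comp P_essSurjOnArrows actNull_isSemiexact Nac.null_isNullIdeal hM.isNullIdeal
      P_exact.2 (e ▸ h)
  exact ⟨fun h => existsUnique_lift hG _ fun H e => ⟨hL H e h.1, hR H e h.2⟩,
    fun h => existsUnique_lift hG _ fun H e => hL H e h,
    fun h => existsUnique_lift hG _ fun H e => hR H e h,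
    fun h => existsUnique_lift hG _ fun H e =>
      ShortExactFunctor.of_comp P_essSurjOnArrows actNull_isSemiexact Nac.null_isNullIdeal
        hM.isNullIdeal P_exact (e ▸ h)⟩
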